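/- Let $\mathcal A$ be a unital pro-$C^*$-algebra, i.e. a unital complete Hausdorff complex topological $*$-algebra in which a net converges to $0$ if and only if $p$ of it converges to $0$ for every $p\in S(\mathcal A)$, where $S(\mathcal A)$ is the set of continuous $C^*$-seminorms (continuous seminorms $p$ with $p(ab)\le p(a)p(b)$ and $p(a^*a)=p(a)^2$). Let $\mathcal X$ be a Hilbert $\mathcal A$-module: a complex vector space and compatible left $\mathcal A$-module with an $\mathcal A$-valued inner product $\langle\cdot,\cdot\rangle$ that is $\mathbb C$- and $\mathcal A$-linear in its first variable, satisfies $\langle\xi,\eta\rangle^*=\langle\eta,\xi\rangle$, $\langle\xi,\xi\rangle\ge 0$, and $\langle\xi,\xi\rangle=0$ only for $\xi=0$, and for which $\mathcal X$ is complete in the topology of the seminorms $\bar p(\xi)=\sqrt{p(\langle\xi,\xi\rangle)}$, $p\in S(\mathcal A)$. Let $Hom^*_{\mathcal A}(\mathcal X)$ be the set of $\mathcal A$-module maps $T:\mathcal X\to\mathcal X$ that are bounded (for each $p\in S(\mathcal A)$ there is $M_p>0$ with $\bar p(T\xi)\le M_p\,\bar p(\xi)$ for all $\xi$) and adjointable (there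 is $T^*:\mathcal X\to\mathcal X$ with $\langle T\xi,\eta\rangle=\langle\xi,T^*\eta\rangle$ for all $\xi,\eta$). For a countable set $I$, a family $\{T_i\}_{i\in I}\subset Hom^*_{\mathcal A}(\mathcal X)$ is called a $*$-operator frame for $\mathcal X$ if there are invertible elements $A,B\in\mathcal A$ such that for every $\xi\in\mathcal X$ the series $\sum_{i\in I}\langle T_i\xi,T_i\xi\rangle$ converges in $\mathcal A$ and $$A\langle\xi,\xi\rangle A^*\le\sum_{i\in I}\langle T_i\xi,T_i\xi\rangle\le B\langle\xi,\xi\rangle B^*.$$ Let $\{T_i\}_{i\in I}$ be a $*$-operator frame for $\mathcal X$. Then its frame operator $S\xi=\sum_{i\in I}T_i^*T_i\xi$ is well defined (the series converges unconditionally in $\mathcal X$ for every $\xi\in\mathcal X$), belongs to $Hom^*_{\mathcal A}(\mathcal X)$ and has an inverse $S^{-1}\in Hom^*_{\mathcal A}(\mathcal X)$, and $\{T_iS^{-1}\}_{i\in I}$ is again a $*$-operator frame for $\mathcal X$. -/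

import Mathlib

open scoped Topology

namespace ProCStar

/-- The set `S(𝒜)` of all continuous C⋆-seminorms on `𝒜`: continuous seminorms `p` with
`p (a b) ≤ p a * p b` and `p (a⋆ a) = (p a)²`. -/
def contCStarSeminorms (𝒜 : Type*) [Ring 𝒜] [StarRing 𝒜] [Algebra ℂ 𝒜] [TopologicalSpace 𝒜] :
    Set (Seminorm ℂ 𝒜) :=
  {p | Continuous p ∧ (∀ a b : 𝒜, p (a * b) ≤ p a * p b) ∧ ∀ a : 𝒜, p (star a * a) = p a ^ 2}

/-- A unital pro-C⋆-algebra: a complete Hausdorff complex topological ⋆-algebra in which a net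
(filter) converges to `0` if and only if `p` of it converges to `0` for every continuous
C⋆-seminorm `p`. Completeness refers to the uniform structure of the additive group. -/
class ProCStarAlgebra (𝒜 : Type*) [Ring 𝒜] [StarRing 𝒜] [Algebra ℂ 𝒜] [StarModule ℂ 𝒜]
    [UniformSpace 𝒜] : Prop extends
    IsUniformAddGroup 𝒜, IsTopologicalRing 𝒜, ContinuousSMul ℂ 𝒜, ContinuousStar 𝒜,
    T2Space 𝒜, CompleteSpace 𝒜 where
  nhds_zero_eq : 𝓝 (0 : 𝒜) = ⨅ p ∈ contCStarSeminorms 𝒜, Filter.comap p (𝓝 0)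

/-- A pre-Hilbert module over `𝒜`: a complex vector space and compatible left `𝒜`-module with an
`𝒜`-valued inner product which is `ℂ`- and `𝒜`-linear in its first variable. -/
class PreHilbertModule (𝒜 X : Type*) [Ring 𝒜] [StarRing 𝒜] [Algebra ℂ 𝒜] [PartialOrder 𝒜]
    [AddCommGroup X] [Module ℂ X] [Module 𝒜 X] [IsScalarTower ℂ 𝒜 X] extends Inner 𝒜 X where
  inner_add_left (ξ η ζ : X) : inner (ξ + η) ζ = inner ξ ζ + inner η ζ
  inner_smul_left (a : 𝒜) (ξ η : X) : inner (a • ξ) η = a * inner ξ η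
  inner_smul_left_complex (z : ℂ) (ξ η : X) : inner (z • ξ) η = z • inner ξ η
  star_inner (ξ η : X) : star (inner ξ η) = inner η ξ
  inner_self_nonneg (ξ : X) : 0 ≤ inner ξ ξ
  inner_self_eq_zero (ξ : X) : inner ξ ξ = 0 ↔ ξ = 0

section Module

variable (𝒜 : Type*) {X : Type*} [Ring 𝒜] [StarRing 𝒜] [Algebra ℂ 𝒜]

/-- The seminorm `p̄(ξ) = √(p ⟨ξ, ξ⟩)` on a pre-Hilbert module. -/
noncomputable def moduleSeminorm {𝒜 : Type*} {X : Type*} [Ring 𝒜] [StarRing 𝒜] [Algebra ℂ 𝒜]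
    [Inner 𝒜 X] (p : Seminorm ℂ 𝒜) (ξ : X) : ℝ :=
  √(p (inner 𝒜 ξ ξ))

/-- A Hilbert module over the pro-C⋆-algebra `𝒜`: a pre-Hilbert module that is complete with
respect to the topology determined by the seminorms `p̄`, `p ∈ S(𝒜)`. -/
class HilbertModule (𝒜 X : Type*) [Ring 𝒜] [StarRing 𝒜] [Algebra ℂ 𝒜] [PartialOrder 𝒜]
    [TopologicalSpace 𝒜] [AddCommGroup X] [Module ℂ X] [Module 𝒜 X] [IsScalarTower ℂ 𝒜 X]
    [UniformSpace X] [IsUniformAddGroup X] extends PreHilbertModule 𝒜 X where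
  nhds_zero_eq :
    𝓝 (0 : X) = ⨅ p ∈ contCStarSeminorms 𝒜, Filter.comap (moduleSeminorm p) (𝓝 0)
  complete : CompleteSpace X

variable [AddCommGroup X] [Module 𝒜 X] [Inner 𝒜 X]

/-- An `𝒜`-module map `T` on `X` is bounded if for each `p ∈ S(𝒜)` there is `M > 0` with
`p̄(T ξ) ≤ M p̄(ξ)` for all `ξ`. -/
def IsBounded [TopologicalSpace 𝒜] (T : Module.End 𝒜 X) : Prop :=
  ∀ p ∈ contCStarSeminorms 𝒜, ∃ M : ℝ, 0 < M ∧
    ∀ ξ : X, moduleSeminorm p (T ξ) ≤ M * moduleSeminorm p ξ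

/-- An `𝒜`-module map `T` on `X` is adjointable if there is a map `T⋆` with
`⟨T ξ, η⟩ = ⟨ξ, T⋆ η⟩` for all `ξ, η`. -/
def IsAdjointable (T : Module.End 𝒜 X) : Prop :=
  ∃ T' : X → X, ∀ ξ η : X, inner 𝒜 (T ξ) η = inner 𝒜 ξ (T' η)

variable (X) in
/-- `Hom⋆_𝒜(X)`: the bounded adjointable `𝒜`-module maps on `X`, as a monoid under composition. -/
def AdjointableHom [TopologicalSpace 𝒜] : Submonoid (Module.End 𝒜 X) where
  carrier := {T | IsBounded 𝒜 T ∧ IsAdjointable 𝒜 T}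
  one_mem' := ⟨fun _ _ => ⟨1, one_pos, fun ξ => by simp⟩, id, fun _ _ => rfl⟩
  mul_mem' := by
    rintro T U ⟨hT, T', hT'⟩ ⟨hU, U', hU'⟩
    refine ⟨fun p hp => ?_, U' ∘ T', fun ξ η => ?_⟩
    · obtain ⟨M, hM, hM'⟩ := hT p hp
      obtain ⟨N, hN, hN'⟩ := hU p hp
      refine ⟨M * N, mul_pos hM hN, fun ξ => ?_⟩
      calc moduleSeminorm p (T (U ξ)) ≤ M * moduleSeminorm p (U ξ) := hM' _
        _ ≤ M * (N * moduleSeminorm p ξ) := by gcongr; exact hN' ξ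
        _ = M * N * moduleSeminorm p ξ := by ring
    · simp [hT', hU']

variable {𝒜}

/-- The adjoint `T⋆` of `T ∈ Hom⋆_𝒜(X)`; it is uniquely determined by `inner_adjoint` when `X` is
a Hilbert module. -/
noncomputable def adjoint [TopologicalSpace 𝒜] (T : AdjointableHom 𝒜 X) : X → X :=
  T.2.2.choose

theorem inner_adjoint [TopologicalSpace 𝒜] (T : AdjointableHom 𝒜 X) (ξ η : X) :
    inner 𝒜 ((T : Module.End 𝒜 X) ξ) η = inner 𝒜 ξ (adjoint T η) :=
  T.2.2.choose_spec ξ η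

/-- `{T i}` is a ⋆-operator frame for `Hom⋆_𝒜(X)`: there are strictly nonzero (that is, invertible)
`A, B ∈ 𝒜` such that, for all `ξ`, the series `∑ ⟨T i ξ, T i ξ⟩` converges in `𝒜` and
`A ⟨ξ, ξ⟩ A⋆ ≤ ∑ ⟨T i ξ, T i ξ⟩ ≤ B ⟨ξ, ξ⟩ B⋆`. -/
def IsStarOperatorFrame [TopologicalSpace 𝒜] [PartialOrder 𝒜] {ι : Type*}
    (T : ι → AdjointableHom 𝒜 X) : Prop :=
  ∃ A B : 𝒜, IsUnit A ∧ IsUnit B ∧ ∀ ξ : X, ∃ s : 𝒜,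
    HasSum (fun i => inner 𝒜 ((T i : Module.End 𝒜 X) ξ) ((T i : Module.End 𝒜 X) ξ)) s ∧
      A * inner 𝒜 ξ ξ * star A ≤ s ∧ s ≤ B * inner 𝒜 ξ ξ * star B

/-- `S ∈ Hom⋆_𝒜(X)` is the frame operator of `{T i}`: `S ξ = ∑ T i⋆ (T i ξ)` for all `ξ`, with
convergence in `X`. -/
def IsFrameOperator [TopologicalSpace 𝒜] [TopologicalSpace X] {ι : Type*}
    (T : ι → AdjointableHom 𝒜 X) (S : AdjointableHom 𝒜 X) : Prop :=
  ∀ ξ : X, HasSum (fun i => adjoint (T i) ((T i : Module.End 𝒜 X) ξ)) ((S : Module.End 𝒜 X) ξ)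

end Module

end ProCStar

/-! Put `⟨Sξ, η⟩ = ∑ ⟨T_i ξ, T_i η⟩`. The frame inequality reads `A⟨ξ,ξ⟩A⋆ ≤ ⟨Sξ,ξ⟩ ≤ B⟨ξ,ξ⟩B⋆`, and
what must be proved is that such a symmetric `S` is invertible with `B⁻¹⟨ξ,ξ⟩B⁻¹⋆ ≤ ⟨S⁻¹ξ,ξ⟩ ≤
A⁻¹⟨ξ,ξ⟩A⁻¹⋆`.

The obstacle is that `ξ ↦ A • ξ` need not be a module map for a general `A`. The inequality itself
removes it: it holds at every `a • ξ`, so `A (a h a⋆) A⋆ ≤ a s a⋆` for all `a`, with `h = ⟨ξ,ξ⟩` and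
`s = ⟨Sξ,ξ⟩`. Taking `a = exp(zk)` and applying Liouville's theorem shows that `A` commutes with
every `k` in its action on the module (`commutator_mul_eq_zero_of_conj_bounded`,
`actsCentrally_of_bounds`). For central actions, `⟨cξ,cξ⟩` is at most a scalar multiple of `⟨ξ,ξ⟩`
in each C⋆-quotient, so both bounds on `S` become scalar ones, one pair for each seminorm.

A Neumann iteration then makes the range of `S` dense for each seminorm. Since `S` is bounded below
and the module is complete, the range is also closed, so `S` is onto. The bounds for `S⁻¹` come from
expanding positive squares (`inverse_lower_bound`, `inverse_upper_bound`). Each seminorm is handled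
in the C⋆-algebra obtained by completing `𝒜` for it (`exists_cstarAlgebra_hom`). -/

namespace ProCStar

universe u

set_option linter.unusedSectionVars false

/-! ### C⋆-seminorms and their completions -/

section Completion

open UniformSpace

variable (E : Type*) [SeminormedRing E] [StarRing E] [NormedAlgebra ℂ E] [StarModule ℂ E]

/-- The completion of a pre-C⋆-algebra is a C⋆-algebra. -/
noncomputable abbrev completionCStarAlgebra (h : ∀ a : E, ‖star a‖ = ‖a‖)
    (h' : ∀ a : E, ‖star a * a‖ = ‖a‖ ^ 2) : CStarAlgebra (Completion E) :=
  have hu : UniformContinuous (star : E → E) :=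
    (AddMonoidHomClass.isometry_of_norm (starAddEquiv : E ≃+ E) h).uniformContinuous
  have hc : Continuous (Completion.map (star : E → E)) := Completion.continuous_map
  letI : StarRing (Completion E) :=
    { star := Completion.map star
      star_involutive := fun x => Completion.induction_on x
        (isClosed_eq (hc.comp hc) continuous_id)
        fun a => by rw [Completion.map_coe hu, Completion.map_coe hu, star_star]
      star_mul := fun x y => Completion.induction_on₂ x y
        (isClosed_eq (hc.comp continuous_mul)
          ((hc.comp continuous_snd).mul (hc.comp continuous_fst)))
        fun a b => by
          rw [← Completion.coe_mul, Completion.map_coe hu, Completion.map_coe hu,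
            Completion.map_coe hu, star_mul, Completion.coe_mul]
      star_add := fun x y => Completion.induction_on₂ x y
        (isClosed_eq (hc.comp continuous_add)
          ((hc.comp continuous_fst).add (hc.comp continuous_snd)))
        fun a b => by
          rw [← Completion.coe_add, Completion.map_coe hu, Completion.map_coe hu,
            Completion.map_coe hu, star_add, Completion.coe_add] }
  { norm_mul_self_le := fun x => Completion.induction_on x
      (isClosed_le (by fun_prop) ((hc.mul continuous_id).norm)) fun a => by
        change ‖(a : Completion E)‖ * ‖(a : Completion E)‖ ≤
          ‖Completion.map star (a : Completion E) * a‖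
        rw [Completion.map_coe hu, ← Completion.coe_mul, Completion.norm_coe, Completion.norm_coe,
          h', sq]
    norm_smul_le := norm_smul_le
    star_smul := fun z x => Completion.induction_on x
      (isClosed_eq (hc.comp (continuous_const_smul z))
        ((continuous_const_smul (star z)).comp hc)) fun a => by
        change Completion.map star (z • (a : Completion E)) =
          star z • Completion.map star (a : Completion E)
        rw [← Completion.coe_smul, Completion.map_coe hu, Completion.map_coe hu, star_smul,
          Completion.coe_smul] }

end Completion

/-- Cancel `p a` in `p a ^ 2 = p (a⋆ a) ≤ p a⋆ * p a`, then exchange `a` and `a⋆`. -/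
theorem cstar_seminorm_star {𝒜 : Type*} [Ring 𝒜] [StarRing 𝒜] [Algebra ℂ 𝒜] {p : Seminorm ℂ 𝒜}
    (hmul : ∀ a b : 𝒜, p (a * b) ≤ p a * p b) (hstar : ∀ a : 𝒜, p (star a * a) = p a ^ 2)
    (a : 𝒜) : p (star a) = p a := by
  have key : ∀ a : 𝒜, p a ≤ p (star a) := fun a => by
    rcases (apply_nonneg p a).eq_or_lt with h | h
    · rw [← h]; exact apply_nonneg p _
    · have := hmul (star a) a
      rw [hstar, sq] at this
      exact le_of_mul_le_mul_right this h
  exact le_antisymm (by simpa using key (star a)) (key a)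

/-- Every C⋆-seminorm is the pullback of the norm of a C⋆-algebra under a ⋆-homomorphism with
dense range. -/
theorem exists_cstarAlgebra_hom {𝒜 : Type u} [Ring 𝒜] [StarRing 𝒜] [Algebra ℂ 𝒜] [StarModule ℂ 𝒜]
    (p : Seminorm ℂ 𝒜) (hmul : ∀ a b : 𝒜, p (a * b) ≤ p a * p b)
    (hstar : ∀ a : 𝒜, p (star a * a) = p a ^ 2) :
    ∃ (C : Type u) (_ : CStarAlgebra C) (_ : PartialOrder C) (_ : StarOrderedRing C)
      (φ : 𝒜 →⋆ₐ[ℂ] C), DenseRange φ ∧ ∀ a, ‖φ a‖ = p a := by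
  let : SeminormedAddCommGroup 𝒜 := p.toAddGroupSeminorm.toSeminormedAddCommGroup
  have hnorm : ∀ a : 𝒜, ‖a‖ = p a := fun _ => rfl
  let : SeminormedRing 𝒜 :=
    { ‹Ring 𝒜›, ‹SeminormedAddCommGroup 𝒜› with
      norm_mul_le := hmul }
  let : NormedAlgebra ℂ 𝒜 :=
    { ‹Algebra ℂ 𝒜› with
      norm_smul_le := fun z a => (map_smul_eq_mul p z a).le }
  have h1 : ∀ a : 𝒜, ‖star a‖ = ‖a‖ := cstar_seminorm_star hmul hstar
  let _ := completionCStarAlgebra 𝒜 h1 hstar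
  let _ := CStarAlgebra.spectralOrder (UniformSpace.Completion 𝒜)
  have h2 : ∀ a : 𝒜, ((star a : 𝒜) : UniformSpace.Completion 𝒜) = star ↑a := fun a =>
    (UniformSpace.Completion.map_coe
      (AddMonoidHomClass.isometry_of_norm (starAddEquiv : 𝒜 ≃+ 𝒜) h1).uniformContinuous a).symm
  exact ⟨UniformSpace.Completion 𝒜, inferInstance, inferInstance,
    CStarAlgebra.spectralOrderedRing _,
    { (UniformSpace.Completion.coeRingHom : 𝒜 →+* UniformSpace.Completion 𝒜) with
      commutes' := fun _ => rfl
      map_star' := h2 }, UniformSpace.Completion.denseRange_coe, UniformSpace.Completion.norm_coe⟩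

/-! ### Inequalities in a C⋆-algebra -/

section CStarAlgebra

variable {C : Type*} [CStarAlgebra C] [PartialOrder C] [StarOrderedRing C]

/-- If `A (a h a⋆) A⋆ ≤ a s a⋆` for all `a`, then every commutator with `A` annihilates `h` from the
left: by Liouville's theorem, the bounded entire map `z ↦ exp(-zk) A exp(zk) √h` is constant. -/
theorem commutator_mul_eq_zero_of_conj_bounded {A h s : C} (hh : 0 ≤ h)
    (H : ∀ a : C, A * (a * h * star a) * star A ≤ a * s * star a) (k : C) :
    (A * k - k * A) * h = 0 := by
  obtain ⟨g, hg⟩ := CStarAlgebra.nonneg_iff_eq_mul_star_self.1 hh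
  let F : ℂ → C := fun z => NormedSpace.exp (z • (-k)) * A * NormedSpace.exp (z • k) * g
  have hderiv : ∀ z, HasDerivAt F
      ((NormedSpace.exp (z • (-k)) * (-k) * A * NormedSpace.exp (z • k) +
        NormedSpace.exp (z • (-k)) * A * (NormedSpace.exp (z • k) * k)) * g) z := fun z =>
    ((((hasDerivAt_exp_smul_const (-k) z).mul_const A).mul
      (hasDerivAt_exp_smul_const k z)).mul_const g)
  let _ : NormedAlgebra ℚ C := NormedAlgebra.restrictScalars ℚ ℂ C
  have hexp : ∀ z : ℂ, NormedSpace.exp (z • (-k)) * NormedSpace.exp (z • k) = 1 := fun z => by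
    rw [smul_neg, ← NormedSpace.exp_add_of_commute (Commute.neg_left rfl), neg_add_cancel,
      NormedSpace.exp_zero]
  -- Conjugating the hypothesis at `a = exp(zk)` by `exp(-zk)` restores `s` on the right and leaves
  -- `F z (F z)⋆` on the left, so the bound does not depend on `z`.
  have hbound : ∀ z, ‖F z‖ ^ 2 ≤ ‖s‖ := fun z => by
    have h1 := star_right_conjugate_le_conjugate (H (NormedSpace.exp (z • k)))
      (NormedSpace.exp (z • (-k)))
    have h2 : NormedSpace.exp (z • (-k)) * (NormedSpace.exp (z • k) * s *
        star (NormedSpace.exp (z • k))) * star (NormedSpace.exp (z • (-k))) = s := by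
      calc _ = (NormedSpace.exp (z • (-k)) * NormedSpace.exp (z • k)) * s *
            star (NormedSpace.exp (z • (-k)) * NormedSpace.exp (z • k)) := by
            rw [star_mul]; noncomm_ring
        _ = s := by rw [hexp]; simp
    have h3 : NormedSpace.exp (z • (-k)) * (A * (NormedSpace.exp (z • k) * h *
        star (NormedSpace.exp (z • k))) * star A) * star (NormedSpace.exp (z • (-k))) =
        F z * star (F z) := by
      simp only [F, hg, star_mul, mul_assoc]
    rw [h2, h3] at h1
    have := CStarAlgebra.norm_le_norm_of_nonneg_of_le (mul_star_self_nonneg _) h1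
    rwa [CStarRing.norm_self_mul_star, ← sq] at this
  have hconst : ∀ z, F z = F 0 := fun z =>
    Differentiable.apply_eq_apply_of_bounded (fun z => (hderiv z).differentiableAt)
      (isBounded_iff_forall_norm_le.2 ⟨√‖s‖, by
        rintro _ ⟨z, rfl⟩; exact Real.le_sqrt_of_sq_le (hbound z)⟩) z 0
  have h0 : HasDerivAt F 0 0 := by
    rw [show F = fun _ => F 0 from funext hconst]; exact hasDerivAt_const _ _
  -- The derivative at `0` is `(-kA + Ak) g`, which therefore vanishes.
  have := (hderiv 0).unique h0
  simp only [zero_smul, NormedSpace.exp_zero, one_mul, mul_one] at this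
  rw [hg, ← mul_assoc, sub_eq_neg_add, ← neg_mul, this, zero_mul]

/-- The difference is `(‖e‖ - e) h`, a product of commuting positive elements. -/
theorem mul_le_norm_smul_of_commute {e h : C} (he : 0 ≤ e) (hh : 0 ≤ h) (hc : Commute e h) :
    e * h ≤ ‖e‖ • h := by
  have h1 : 0 ≤ algebraMap ℝ C ‖e‖ - e :=
    sub_nonneg.2 (IsSelfAdjoint.of_nonneg he).le_algebraMap_norm_self
  have h2 : Commute (algebraMap ℝ C ‖e‖ - e) h := (Algebra.commute_algebraMap_left _ _).sub_left hc
  have := h2.mul_nonneg h1 hh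
  rwa [sub_mul, sub_nonneg, ← Algebra.smul_def] at this

/-- The Cauchy–Schwarz inequality, for the entries of a positive `2 × 2` Gram matrix. -/
theorem norm_sq_le_of_gram_nonneg {u v w : C} (hv : 0 ≤ v)
    (H : ∀ r : ℝ, 0 ≤ u - r • (w * star w) - r • (w * star w) + r • r • (w * v * star w)) :
    ‖w‖ ^ 2 ≤ ‖u‖ * ‖v‖ := by
  -- The optimal choice would be `r = ‖v‖⁻¹`. Using `r = c⁻¹` with `c > ‖v‖` also covers `v = 0`,
  -- and `c` tends to `‖v‖` at the end.
  have key : ∀ c : ℝ, ‖v‖ < c → ‖w‖ ^ 2 ≤ ‖u‖ * c := fun c hc => by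
    have hc0 : 0 < c := (norm_nonneg v).trans_lt hc
    have h1 : w * v * star w ≤ c • (w * star w) := by
      have h2 : v ≤ algebraMap ℝ C c := (IsSelfAdjoint.of_nonneg hv).le_algebraMap_norm_self.trans
        (algebraMap_mono C hc.le)
      simpa [Algebra.algebraMap_eq_smul_one] using star_right_conjugate_le_conjugate h2 w
    have h3 : w * star w ≤ c • u := by
      have h4 := H c⁻¹
      have h5 : c⁻¹ • c⁻¹ • (w * v * star w) ≤ c⁻¹ • (w * star w) := by
        have := smul_le_smul_of_nonneg_left h1 (by positivity : 0 ≤ c⁻¹ * c⁻¹)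
        rw [smul_smul _ c, mul_assoc c⁻¹, inv_mul_cancel₀ hc0.ne', mul_one] at this
        rwa [smul_smul]
      have h6 : 0 ≤ u - c⁻¹ • (w * star w) := h4.trans (by
        calc _ ≤ u - c⁻¹ • (w * star w) - c⁻¹ • (w * star w) + c⁻¹ • (w * star w) := by gcongr
          _ = _ := by abel)
      have := smul_le_smul_of_nonneg_left (sub_nonneg.1 h6) hc0.le
      rwa [smul_smul, mul_inv_cancel₀ hc0.ne', one_smul] at this
    have := CStarAlgebra.norm_le_norm_of_nonneg_of_le (mul_star_self_nonneg _) h3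
    rw [CStarRing.norm_self_mul_star, ← sq, norm_smul, Real.norm_of_nonneg hc0.le] at this
    linarith
  refine le_of_forall_pos_le_add fun ε hε => ?_
  have := key (‖v‖ + ε / (‖u‖ + 1)) (lt_add_of_pos_right _ (by positivity))
  refine this.trans ?_
  rw [mul_add]
  gcongr
  rw [mul_div_assoc', div_le_iff₀ (by positivity)]
  nlinarith [norm_nonneg u]

end CStarAlgebra

/-! ### Algebra of the inner product and Cauchy–Schwarz -/

section Inner

variable {𝒜 X : Type*} [Ring 𝒜] [StarRing 𝒜] [Algebra ℂ 𝒜] [PartialOrder 𝒜]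
  [AddCommGroup X] [Module ℂ X] [Module 𝒜 X] [IsScalarTower ℂ 𝒜 X] [PreHilbertModule 𝒜 X]

/-- The inner product as an additive map in its first variable. -/
def innerLeft (η : X) : X →+ 𝒜 := AddMonoidHom.mk' (fun ξ => inner 𝒜 ξ η) fun _ _ =>
  PreHilbertModule.inner_add_left _ _ _

theorem inner_add_right (ξ η ζ : X) : inner 𝒜 ξ (η + ζ) = inner 𝒜 ξ η + inner 𝒜 ξ ζ := by
  rw [← PreHilbertModule.star_inner, PreHilbertModule.inner_add_left, star_add,
    PreHilbertModule.star_inner, PreHilbertModule.star_inner]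

/-- The inner product as an additive map in its second variable. -/
def innerRight (ξ : X) : X →+ 𝒜 := AddMonoidHom.mk' (fun η => inner 𝒜 ξ η) fun _ _ =>
  inner_add_right _ _ _

theorem inner_sub_left (ξ η ζ : X) : inner 𝒜 (ξ - η) ζ = inner 𝒜 ξ ζ - inner 𝒜 η ζ :=
  map_sub (innerLeft ζ) ξ η

theorem inner_sub_right (ξ η ζ : X) : inner 𝒜 ξ (η - ζ) = inner 𝒜 ξ η - inner 𝒜 ξ ζ :=
  map_sub (innerRight ξ) η ζ

theorem inner_zero_right (ξ : X) : inner 𝒜 ξ (0 : X) = 0 := map_zero (innerRight ξ)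

theorem inner_smul_right (a : 𝒜) (ξ η : X) : inner 𝒜 ξ (a • η) = inner 𝒜 ξ η * star a := by
  rw [← PreHilbertModule.star_inner, PreHilbertModule.inner_smul_left, star_mul,
    PreHilbertModule.star_inner]

theorem inner_sum_left {ι : Type*} (F : Finset ι) (f : ι → X) (η : X) :
    inner 𝒜 (∑ i ∈ F, f i) η = ∑ i ∈ F, inner 𝒜 (f i) η :=
  map_sum (innerLeft η) f F

theorem inner_smul_smul (a : 𝒜) (ξ η : X) :
    inner 𝒜 (a • ξ) (a • η) = a * inner 𝒜 ξ η * star a := by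
  rw [inner_smul_right, PreHilbertModule.inner_smul_left]

variable (𝒜) in
theorem ext_inner_left {η ζ : X} (h : ∀ ξ : X, inner 𝒜 ξ η = inner 𝒜 ξ ζ) : η = ζ := by
  rw [← sub_eq_zero, ← PreHilbertModule.inner_self_eq_zero (𝒜 := 𝒜), inner_sub_right, h, sub_self]

theorem isSelfAdjoint_inner_self (ξ : X) : IsSelfAdjoint (inner 𝒜 ξ ξ) :=
  PreHilbertModule.star_inner ξ ξ

/-- A map that is symmetric for the inner product is a module map. -/
def endOfSymmetric (S : X → X) (hS : ∀ ξ η, inner 𝒜 (S ξ) η = inner 𝒜 ξ (S η)) :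
    Module.End 𝒜 X where
  toFun := S
  map_add' ξ η := ext_inner_left 𝒜 fun ζ => by
    rw [← hS, inner_add_right, inner_add_right, hS, hS]
  map_smul' a ξ := ext_inner_left 𝒜 fun ζ => by
    rw [← hS, RingHom.id_apply, inner_smul_right, inner_smul_right, hS]

/-- Expansion of the form `⟨R ξ, η⟩` of a symmetric map. -/
theorem inner_symmetric_sub_smul {R : X → X} (hR : ∀ ξ η, inner 𝒜 (R ξ) η = inner 𝒜 ξ (R η))
    (ξ η : X) (a : 𝒜) :
    inner 𝒜 (R (ξ - a • η)) (ξ - a • η) = inner 𝒜 (R ξ) ξ - inner 𝒜 (R ξ) η * star a -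
      a * star (inner 𝒜 (R ξ) η) + a * inner 𝒜 (R η) η * star a := by
  rw [hR (ξ - a • η), inner_sub_left, PreHilbertModule.inner_smul_left, ← hR, ← hR, inner_sub_right,
    inner_sub_right, inner_smul_right, inner_smul_right, hR η ξ, PreHilbertModule.star_inner]
  noncomm_ring

section Hom

variable {C : Type*} [CStarAlgebra C] [PartialOrder C] [StarOrderedRing C] (φ : 𝒜 →⋆ₐ[ℂ] C)

/-- The Cauchy–Schwarz inequality for the form of a positive symmetric map. -/
theorem norm_inner_symmetric_sq_le {R : X → X}
    (hR : ∀ ξ η, inner 𝒜 (R ξ) η = inner 𝒜 ξ (R η)) (hpos : ∀ ξ, 0 ≤ φ (inner 𝒜 (R ξ) ξ))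
    (ξ η : X) :
    ‖φ (inner 𝒜 (R ξ) η)‖ ^ 2 ≤ ‖φ (inner 𝒜 (R ξ) ξ)‖ * ‖φ (inner 𝒜 (R η) η)‖ := by
  refine norm_sq_le_of_gram_nonneg (hpos η) fun r => ?_
  -- Positivity at `ξ - r w η` with `w = ⟨Rξ, η⟩` is exactly the Gram inequality.
  have := hpos (ξ - ((r : ℂ) • inner 𝒜 (R ξ) η) • η)
  rw [inner_symmetric_sub_smul hR] at this
  have hstar : star ((r : ℂ) • φ (inner 𝒜 (R ξ) η)) = r • star (φ (inner 𝒜 (R ξ) η)) := by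
    rw [Complex.coe_smul, star_smul, star_trivial]
  simp only [map_sub, map_add, map_mul, map_star, map_smul, hstar] at this
  simpa only [Complex.coe_smul, mul_smul_comm, smul_mul_assoc] using this

/-- This plays the role of `R² ≤ M R`: apply Cauchy–Schwarz to the pair `ξ, Rξ`, bound `⟨R(Rξ), Rξ⟩`
by `M ⟨Rξ, Rξ⟩` in norm, and cancel one factor `‖⟨Rξ, Rξ⟩‖`. -/
theorem norm_inner_apply_self_le {R : X → X}
    (hR : ∀ ξ η, inner 𝒜 (R ξ) η = inner 𝒜 ξ (R η)) (hpos : ∀ ξ, 0 ≤ φ (inner 𝒜 (R ξ) ξ))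
    {M : ℝ} (hM0 : 0 ≤ M) (hM : ∀ ξ, ‖φ (inner 𝒜 (R ξ) ξ)‖ ≤ M * ‖φ (inner 𝒜 ξ ξ)‖) (ξ : X) :
    ‖φ (inner 𝒜 (R ξ) (R ξ))‖ ≤ M * ‖φ (inner 𝒜 (R ξ) ξ)‖ := by
  have h1 := norm_inner_symmetric_sq_le φ hR hpos ξ (R ξ)
  have h2 := mul_le_mul_of_nonneg_left (hM (R ξ)) (norm_nonneg (φ (inner 𝒜 (R ξ) ξ)))
  rcases (norm_nonneg (φ (inner 𝒜 (R ξ) (R ξ)))).eq_or_lt with h | h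
  · rw [← h]
    positivity
  · refine le_of_mul_le_mul_right ?_ h
    nlinarith

end Hom

end Inner

/-! ### Topology of the algebra and of the module -/

section Topology

variable {𝒜 : Type*} [Ring 𝒜] [StarRing 𝒜] [Algebra ℂ 𝒜] [StarModule ℂ 𝒜] [UniformSpace 𝒜]

theorem exists_cstarAlgebra_hom_of_mem {𝒜 : Type u} [Ring 𝒜] [StarRing 𝒜] [Algebra ℂ 𝒜]
    [StarModule ℂ 𝒜] [UniformSpace 𝒜] {p : Seminorm ℂ 𝒜} (hp : p ∈ contCStarSeminorms 𝒜) :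
    ∃ (C : Type u) (_ : CStarAlgebra C) (_ : PartialOrder C) (_ : StarOrderedRing C)
      (φ : 𝒜 →⋆ₐ[ℂ] C), DenseRange φ ∧ ∀ a, ‖φ a‖ = p a :=
  exists_cstarAlgebra_hom p hp.2.1 hp.2.2

theorem eq_zero_of_forall_seminorm [ProCStarAlgebra 𝒜] {a : 𝒜}
    (h : ∀ p ∈ contCStarSeminorms 𝒜, p a = 0) : a = 0 := by
  refine pure_le_nhds_iff.1 ?_
  rw [ProCStarAlgebra.nhds_zero_eq]
  refine le_iInf₂ fun p hp => ?_
  rw [← Filter.map_le_iff_le_comap, Filter.map_pure, h p hp]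
  exact pure_le_nhds 0

theorem eq_zero_of_mul_star_self [ProCStarAlgebra 𝒜] {a : 𝒜} (h : a * star a = 0) : a = 0 := by
  refine star_eq_zero.1 (eq_zero_of_forall_seminorm fun p hp => ?_)
  have := hp.2.2 (star a)
  rw [star_star, h, map_zero] at this
  exact pow_eq_zero_iff two_ne_zero |>.1 this.symm

variable (𝒜) in
theorem zero_mem_contCStarSeminorms : (0 : Seminorm ℂ 𝒜) ∈ contCStarSeminorms 𝒜 :=
  ⟨continuous_const, fun _ _ => by simp, fun _ => by simp⟩

theorem sup_mem_contCStarSeminorms {p q : Seminorm ℂ 𝒜} (hp : p ∈ contCStarSeminorms 𝒜)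
    (hq : q ∈ contCStarSeminorms 𝒜) : p ⊔ q ∈ contCStarSeminorms 𝒜 := by
  refine ⟨hp.1.sup hq.1, fun a b => ?_, fun a => ?_⟩
  · exact sup_le ((hp.2.1 a b).trans (mul_le_mul le_sup_left le_sup_left (apply_nonneg _ _)
      ((apply_nonneg p a).trans le_sup_left)))
      ((hq.2.1 a b).trans (mul_le_mul le_sup_right le_sup_right (apply_nonneg _ _)
      ((apply_nonneg p a).trans le_sup_left)))
  · change max (p _) (q _) = (max (p a) (q a)) ^ 2
    rw [hp.2.2, hq.2.2]
    rcases le_total (p a) (q a) with h | h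
    · rw [max_eq_right h, max_eq_right (pow_le_pow_left₀ (apply_nonneg _ _) h 2)]
    · rw [max_eq_left h, max_eq_left (pow_le_pow_left₀ (apply_nonneg _ _) h 2)]

variable [PartialOrder 𝒜] [StarOrderedRing 𝒜] {X : Type*}
    [AddCommGroup X] [Module ℂ X] [Module 𝒜 X] [IsScalarTower ℂ 𝒜 X]

section PreHilbert

variable [PreHilbertModule 𝒜 X] {p : Seminorm ℂ 𝒜}

theorem moduleSeminorm_nonneg (p : Seminorm ℂ 𝒜) (ξ : X) : 0 ≤ moduleSeminorm p ξ :=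
  Real.sqrt_nonneg _

theorem moduleSeminorm_sq (p : Seminorm ℂ 𝒜) (ξ : X) :
    moduleSeminorm p ξ ^ 2 = p (inner 𝒜 ξ ξ) := Real.sq_sqrt (apply_nonneg _ _)

theorem moduleSeminorm_mono {p q : Seminorm ℂ 𝒜} (h : p ≤ q) (ξ : X) :
    moduleSeminorm p ξ ≤ moduleSeminorm q ξ := Real.sqrt_le_sqrt (h _)

theorem moduleSeminorm_zero (p : Seminorm ℂ 𝒜) : moduleSeminorm p (0 : X) = 0 := by
  rw [moduleSeminorm, inner_zero_right, map_zero, Real.sqrt_zero]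

theorem seminorm_inner_le (hp : p ∈ contCStarSeminorms 𝒜) (ξ η : X) :
    p (inner 𝒜 ξ η) ≤ moduleSeminorm p ξ * moduleSeminorm p η := by
  obtain ⟨C, _, _, _, φ, -, hφ⟩ := exists_cstarAlgebra_hom_of_mem hp
  have := norm_inner_symmetric_sq_le φ (R := id) (fun _ _ => rfl)
    (fun ξ => map_nonneg φ (PreHilbertModule.inner_self_nonneg ξ)) ξ η
  simp only [hφ, id, ← moduleSeminorm_sq, ← mul_pow] at this
  exact le_of_sq_le_sq this (mul_nonneg (moduleSeminorm_nonneg _ _) (moduleSeminorm_nonneg _ _))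

theorem seminorm_mono (hp : p ∈ contCStarSeminorms 𝒜) {a b : 𝒜} (ha : 0 ≤ a) (hab : a ≤ b) :
    p a ≤ p b := by
  obtain ⟨C, _, _, _, φ, -, hφ⟩ := exists_cstarAlgebra_hom_of_mem hp
  rw [← hφ, ← hφ]
  exact CStarAlgebra.norm_le_norm_of_nonneg_of_le (map_nonneg φ ha) (OrderHomClass.mono φ hab)

end PreHilbert

variable [UniformSpace X] [IsUniformAddGroup X] [HilbertModule 𝒜 X]

-- A single seminorm suffices because the C⋆-seminorms are directed: the maximum of two of them is
-- again one.
variable (𝒜) in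
theorem mem_nhds_zero_iff {e : Set X} : e ∈ 𝓝 (0 : X) ↔
    ∃ p ∈ contCStarSeminorms 𝒜, ∃ ε > 0, ∀ ξ : X, moduleSeminorm p ξ < ε → ξ ∈ e := by
  have hcomap : ∀ p : Seminorm ℂ 𝒜, ∀ e : Set X, e ∈ Filter.comap (moduleSeminorm p) (𝓝 0) ↔
      ∃ ε > 0, ∀ ξ : X, moduleSeminorm p ξ < ε → ξ ∈ e := fun p e => by
    rw [((Metric.nhds_basis_ball (x := (0 : ℝ))).comap _).mem_iff]
    simp only [Set.subset_def, Set.mem_preimage, mem_ball_zero_iff, Real.norm_eq_abs,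
      abs_of_nonneg (moduleSeminorm_nonneg _ _)]
  rw [HilbertModule.nhds_zero_eq (𝒜 := 𝒜), Filter.mem_biInf_of_directed]
  · simp only [hcomap]
  · have hmono : ∀ p q : Seminorm ℂ 𝒜, p ≤ q →
        Filter.comap (moduleSeminorm q : X → ℝ) (𝓝 0) ≤ Filter.comap (moduleSeminorm p) (𝓝 0) :=
      fun p q h e he => by
        rw [hcomap] at he ⊢
        obtain ⟨ε, hε, H⟩ := he
        exact ⟨ε, hε, fun ξ hξ => H ξ ((moduleSeminorm_mono h ξ).trans_lt hξ)⟩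
    exact fun p hp q hq => ⟨p ⊔ q, sup_mem_contCStarSeminorms hp hq, hmono _ _ le_sup_left,
      hmono _ _ le_sup_right⟩
  · exact ⟨0, zero_mem_contCStarSeminorms 𝒜⟩

theorem tendsto_moduleSeminorm {p : Seminorm ℂ 𝒜} (hp : p ∈ contCStarSeminorms 𝒜) :
    Filter.Tendsto (moduleSeminorm p : X → ℝ) (𝓝 0) (𝓝 0) := by
  rw [Filter.tendsto_iff_comap, HilbertModule.nhds_zero_eq (𝒜 := 𝒜)]
  exact iInf₂_le p hp

variable (𝒜) in
theorem t2Space_of_hilbertModule [ProCStarAlgebra 𝒜] : T2Space X := by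
  refine IsTopologicalAddGroup.t2Space_of_zero_sep fun ξ hξ => ?_
  have : ∃ p ∈ contCStarSeminorms 𝒜, p (inner 𝒜 ξ ξ) ≠ 0 := by
    by_contra! h
    exact hξ ((PreHilbertModule.inner_self_eq_zero ξ).1 (eq_zero_of_forall_seminorm h))
  obtain ⟨p, hp, h⟩ := this
  have hpos : 0 < moduleSeminorm p ξ :=
    Real.sqrt_pos.2 ((apply_nonneg _ _).lt_of_ne' h)
  exact ⟨{ζ | moduleSeminorm p ζ < moduleSeminorm p ξ},
    (mem_nhds_zero_iff 𝒜).2 ⟨p, hp, _, hpos, fun _ h => h⟩, lt_irrefl (moduleSeminorm p ξ)⟩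

theorem continuous_inner_left [ProCStarAlgebra 𝒜] (η : X) :
    Continuous fun ξ : X => inner 𝒜 ξ η := by
  refine continuous_of_continuousAt_zero (innerLeft η) ?_
  rw [ContinuousAt, map_zero, ProCStarAlgebra.nhds_zero_eq]
  simp only [Filter.tendsto_iInf, Filter.tendsto_comap_iff]
  intro p hp
  refine squeeze_zero (fun _ => apply_nonneg _ _) (fun ξ => seminorm_inner_le hp ξ η) ?_
  simpa using (tendsto_moduleSeminorm (X := X) hp).mul_const (moduleSeminorm p η)

end Topology

/-! ### Elements acting centrally on the module -/

section Central

variable {𝒜 : Type u} {X : Type*} [Ring 𝒜] [StarRing 𝒜] [Algebra ℂ 𝒜] [StarModule ℂ 𝒜]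
  [UniformSpace 𝒜] [ProCStarAlgebra 𝒜] [PartialOrder 𝒜] [StarOrderedRing 𝒜]
  [AddCommGroup X] [Module ℂ X] [Module 𝒜 X] [IsScalarTower ℂ 𝒜 X] [PreHilbertModule 𝒜 X]

variable (X) in
/-- The element `c` acts on `X` by a module map. -/
def ActsCentrally (c : 𝒜) : Prop := ∀ (k : 𝒜) (ξ : X), c • k • ξ = k • c • ξ

theorem ActsCentrally.of_mul_eq_one {c d : 𝒜} (hc : ActsCentrally X c) (hdc : d * c = 1)
    (hcd : c * d = 1) : ActsCentrally X d := fun k ξ => by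
  calc d • k • ξ = d • k • (c * d) • ξ := by rw [hcd, one_smul]
    _ = (d * c) • k • d • ξ := by rw [mul_smul, ← hc, mul_smul]
    _ = k • d • ξ := by rw [hdc, one_smul]

/-- With `m = ⟨ξ, η⟩`, the commutator `d = cm - mc` kills the module, hence is a left annihilator of
all inner products. Both `m⋆ = ⟨η, ξ⟩` and `c⋆ m⋆ = ⟨c⋆η, ξ⟩` are inner products, so `d d⋆ = 0`. -/
theorem ActsCentrally.inner_smul_left {c : 𝒜} (hc : ActsCentrally X c) (ξ η : X) :
    inner 𝒜 (c • ξ) η = inner 𝒜 ξ (star c • η) := by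
  rw [PreHilbertModule.inner_smul_left, inner_smul_right, star_star, ← sub_eq_zero]
  set m := inner 𝒜 ξ η with hm
  have hd : ∀ ζ : X, (c * m - m * c) • ζ = 0 := fun ζ => by
    rw [sub_smul, mul_smul, mul_smul, hc, sub_self]
  have hd' : ∀ ζ ω : X, (c * m - m * c) * inner 𝒜 ζ ω = 0 := fun ζ ω => by
    rw [← PreHilbertModule.inner_smul_left, hd, ← PreHilbertModule.star_inner, inner_zero_right,
      star_zero]
  apply eq_zero_of_mul_star_self
  have h1 := hd' η ξ
  have h2 := hd' (star c • η) ξ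
  rw [← PreHilbertModule.star_inner, ← hm] at h1
  rw [PreHilbertModule.inner_smul_left, ← PreHilbertModule.star_inner ξ η, ← hm] at h2
  rw [star_sub, star_mul, star_mul, mul_sub, ← mul_assoc, h1, zero_mul, h2, sub_zero]

theorem ActsCentrally.star {c : 𝒜} (hc : ActsCentrally X c) : ActsCentrally X (star c) :=
  fun k ξ => ext_inner_left 𝒜 fun ζ => by
    rw [← hc.inner_smul_left, inner_smul_right, inner_smul_right, hc.inner_smul_left]

/-- Here `⟨cξ, cξ⟩ = c c⋆ ⟨ξ, ξ⟩`. Self-adjointness of the left side makes the two positive factors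
commute, so `c c⋆` may be replaced by its norm. -/
theorem ActsCentrally.map_inner_smul_smul_le {C : Type*} [CStarAlgebra C] [PartialOrder C]
    [StarOrderedRing C] (φ : 𝒜 →⋆ₐ[ℂ] C) {c : 𝒜} (hc : ActsCentrally X c) (ξ : X) :
    φ (inner 𝒜 (c • ξ) (c • ξ)) ≤ ‖φ c‖ ^ 2 • φ (inner 𝒜 ξ ξ) := by
  have h1 : inner 𝒜 (c • ξ) (c • ξ) = c * Star.star c * inner 𝒜 ξ ξ := by
    have := hc.star.inner_smul_left ξ ξ
    rw [star_star] at this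
    rw [PreHilbertModule.inner_smul_left, ← this, PreHilbertModule.inner_smul_left, mul_assoc]
  have hcomm : Commute (c * Star.star c) (inner 𝒜 ξ ξ) := by
    have h2 := isSelfAdjoint_inner_self (𝒜 := 𝒜) (c • ξ)
    rw [h1, isSelfAdjoint_iff, star_mul, (isSelfAdjoint_inner_self ξ).star_eq,
      (IsSelfAdjoint.mul_star_self c).star_eq] at h2
    exact h2.symm
  have h3 := mul_le_norm_smul_of_commute (e := φ (c * Star.star c)) (h := φ (inner 𝒜 ξ ξ))
    (map_nonneg φ (mul_star_self_nonneg c)) (map_nonneg φ (PreHilbertModule.inner_self_nonneg ξ))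
    (hcomm.map φ)
  rwa [← map_mul, ← h1, map_mul, map_star, CStarRing.norm_self_mul_star, ← sq] at h3

/-- If `c u(ξ) c⋆ ≤ v(ξ)` for maps `u`, `v` with `u(aξ) = a u(ξ) a⋆` and `v(aξ) = a v(ξ) a⋆`, then
commutators with `c` annihilate `u(ξ)` from the left. -/
theorem commutator_mul_eq_zero {c : 𝒜} {u v : X → 𝒜} (hu : ∀ ξ, 0 ≤ u ξ)
    (hu' : ∀ (a : 𝒜) ξ, u (a • ξ) = a * u ξ * star a)
    (hv' : ∀ (a : 𝒜) ξ, v (a • ξ) = a * v ξ * star a)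
    (H : ∀ ξ, c * u ξ * star c ≤ v ξ) (k : 𝒜) (ξ : X) :
    (c * k - k * c) * u ξ = 0 := by
  refine eq_zero_of_forall_seminorm fun p hp => ?_
  obtain ⟨C, _, _, _, φ, hd, hφ⟩ := exists_cstarAlgebra_hom_of_mem hp
  have := commutator_mul_eq_zero_of_conj_bounded (A := φ c) (s := φ (v ξ)) (map_nonneg φ (hu ξ))
    -- The inequality is closed in `a` and the range of `φ` is dense, so it is enough to evaluate
    -- `H` at `a • ξ` with `a` in `𝒜`.
    (fun a => hd.induction_on a (isClosed_le (by fun_prop) (by fun_prop)) fun a => by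
      have := OrderHomClass.mono φ (H (a • ξ))
      simpa only [hu', hv', map_mul, map_star] using this) (φ k)
  rw [← hφ, map_mul, map_sub, map_mul, map_mul, this, norm_zero]

theorem smul_eq_zero_of_mul_inner_self {y : 𝒜} {ξ : X} (h : y * inner 𝒜 ξ ξ = 0) : y • ξ = 0 := by
  rw [← PreHilbertModule.inner_self_eq_zero (𝒜 := 𝒜), inner_smul_smul, h, zero_mul]

theorem inner_map_smul (S : Module.End 𝒜 X) (a : 𝒜) (ξ : X) :
    inner 𝒜 (S (a • ξ)) (a • ξ) = a * inner 𝒜 (S ξ) ξ * star a := by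
  rw [map_smul, inner_smul_smul]

/-- The constants in the bounds of a positive module map act centrally. -/
theorem actsCentrally_of_bounds {A a B b : 𝒜} (hAa : A * a = 1) (hBb : B * b = 1)
    (hbB : b * B = 1) (S : Module.End 𝒜 X)
    (hA : ∀ ξ, A * inner 𝒜 ξ ξ * star A ≤ inner 𝒜 (S ξ) ξ)
    (hB : ∀ ξ, inner 𝒜 (S ξ) ξ ≤ B * inner 𝒜 ξ ξ * star B) :
    ActsCentrally X A ∧ ActsCentrally X B := by
  have hpos : ∀ ξ : X, 0 ≤ inner 𝒜 (S ξ) ξ := fun ξ =>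
    (star_right_conjugate_nonneg (PreHilbertModule.inner_self_nonneg ξ) A).trans (hA ξ)
  constructor
  · intro k ξ
    have := commutator_mul_eq_zero (X := X) (u := fun ξ => inner 𝒜 ξ ξ)
      PreHilbertModule.inner_self_nonneg
      (fun a ξ => inner_smul_smul a ξ ξ) (inner_map_smul S) hA k ξ
    rw [← sub_eq_zero, ← mul_smul, ← mul_smul, ← sub_smul]
    exact smul_eq_zero_of_mul_inner_self this
  · refine ActsCentrally.of_mul_eq_one (c := b) (fun k ξ => ?_) hBb hbB
    rw [← sub_eq_zero, ← mul_smul, ← mul_smul, ← sub_smul]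
    -- The upper bound gives `b⟨Sξ,ξ⟩b⋆ ≤ ⟨ξ,ξ⟩`, so the commutator of `b` and `k` annihilates
    -- `⟨Sξ,ξ⟩`. Conjugating the lower bound by it shows that it also kills `A • ξ`, and every
    -- vector has this form.
    have key : ∀ ξ : X, (b * k - k * b) • A • ξ = 0 := fun ξ => by
      have h1 := commutator_mul_eq_zero (X := X) (u := fun ξ => inner 𝒜 (S ξ) ξ) (c := b)
        (v := fun ξ => inner 𝒜 ξ ξ)
        hpos (inner_map_smul S) (fun a ξ => inner_smul_smul a ξ ξ) (fun ξ => by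
          calc _ ≤ b * (B * inner 𝒜 ξ ξ * star B) * star b :=
                star_right_conjugate_le_conjugate (hB ξ) b
            _ = (b * B) * inner 𝒜 ξ ξ * star (b * B) := by rw [star_mul]; noncomm_ring
            _ = inner 𝒜 ξ ξ := by rw [hbB, star_one, one_mul, mul_one]) k ξ
      have h2 := star_right_conjugate_le_conjugate (hA ξ) (b * k - k * b)
      rw [h1, zero_mul, ← inner_smul_smul, ← inner_smul_smul] at h2
      exact (PreHilbertModule.inner_self_eq_zero (𝒜 := 𝒜) _).1
        (le_antisymm h2 (PreHilbertModule.inner_self_nonneg _))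
    simpa only [← mul_smul A, hAa, one_smul] using key (a • ξ)

end Central

/-! ### Scalar estimates for `S` and bounds for its inverse -/

section Inverse

variable {𝒜 : Type u} {X : Type*} [Ring 𝒜] [StarRing 𝒜] [Algebra ℂ 𝒜] [StarModule ℂ 𝒜]
  [UniformSpace 𝒜] [ProCStarAlgebra 𝒜] [PartialOrder 𝒜] [StarOrderedRing 𝒜]
  [AddCommGroup X] [Module ℂ X] [Module 𝒜 X] [IsScalarTower ℂ 𝒜 X]

section PreHilbert

variable [PreHilbertModule 𝒜 X] {S : Module.End 𝒜 X} {A a B b : 𝒜}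

section Hom

variable {C : Type*} [CStarAlgebra C] [PartialOrder C] [StarOrderedRing C] (φ : 𝒜 →⋆ₐ[ℂ] C)

theorem exists_map_inner_le (hcB : ActsCentrally X B)
    (hB : ∀ ξ, inner 𝒜 (S ξ) ξ ≤ B * inner 𝒜 ξ ξ * star B) :
    ∃ β : ℝ, 1 ≤ β ∧ ∀ ξ : X, φ (inner 𝒜 (S ξ) ξ) ≤ β • φ (inner 𝒜 ξ ξ) := by
  refine ⟨‖φ B‖ ^ 2 + 1, by nlinarith [sq_nonneg ‖φ B‖], fun ξ => ?_⟩
  calc φ (inner 𝒜 (S ξ) ξ) ≤ φ (inner 𝒜 (B • ξ) (B • ξ)) := by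
        rw [inner_smul_smul]; exact OrderHomClass.mono φ (hB ξ)
    _ ≤ ‖φ B‖ ^ 2 • φ (inner 𝒜 ξ ξ) := hcB.map_inner_smul_smul_le φ ξ
    _ ≤ (‖φ B‖ ^ 2 + 1) • φ (inner 𝒜 ξ ξ) :=
      smul_le_smul_of_nonneg_right (by linarith)
        (map_nonneg φ (PreHilbertModule.inner_self_nonneg ξ))

theorem exists_le_map_inner (hca : ActsCentrally X a) (haA : a * A = 1)
    (hA : ∀ ξ, A * inner 𝒜 ξ ξ * star A ≤ inner 𝒜 (S ξ) ξ) :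
    ∃ α : ℝ, 1 ≤ α ∧ ∀ ξ : X, φ (inner 𝒜 ξ ξ) ≤ α • φ (inner 𝒜 (S ξ) ξ) := by
  refine ⟨‖φ a‖ ^ 2 + 1, by nlinarith [sq_nonneg ‖φ a‖], fun ξ => ?_⟩
  calc φ (inner 𝒜 ξ ξ) = φ (inner 𝒜 (a • A • ξ) (a • A • ξ)) := by
        rw [← mul_smul, haA, one_smul]
    _ ≤ ‖φ a‖ ^ 2 • φ (inner 𝒜 (A • ξ) (A • ξ)) := hca.map_inner_smul_smul_le φ _
    _ ≤ (‖φ a‖ ^ 2 + 1) • φ (inner 𝒜 (A • ξ) (A • ξ)) :=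
      smul_le_smul_of_nonneg_right (by linarith)
        (map_nonneg φ (PreHilbertModule.inner_self_nonneg _))
    _ ≤ (‖φ a‖ ^ 2 + 1) • φ (inner 𝒜 (S ξ) ξ) := by
        rw [inner_smul_smul]
        exact smul_le_smul_of_nonneg_left (OrderHomClass.mono φ (hA ξ)) (by positivity)

end Hom

theorem map_complex_smul (S : Module.End 𝒜 X) (z : ℂ) (ξ : X) : S (z • ξ) = z • S ξ := by
  rw [← algebraMap_smul 𝒜 z ξ, map_smul, algebraMap_smul]

theorem moduleSeminorm_le_of_sq_le {p : Seminorm ℂ 𝒜} {ξ η : X} {M : ℝ} (hM : 0 ≤ M)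
    (h : p (inner 𝒜 ξ ξ) ≤ M ^ 2 * p (inner 𝒜 η η)) :
    moduleSeminorm p ξ ≤ M * moduleSeminorm p η := by
  refine le_of_sq_le_sq ?_ (mul_nonneg hM (moduleSeminorm_nonneg _ _))
  rwa [mul_pow, moduleSeminorm_sq, moduleSeminorm_sq]

theorem inner_real_smul_left (r : ℝ) (ξ η : X) :
    inner 𝒜 ((r : ℂ) • ξ) η = (r : ℂ) • inner 𝒜 ξ η :=
  PreHilbertModule.inner_smul_left_complex _ _ _

theorem inner_real_smul_right (r : ℝ) (ξ η : X) :
    inner 𝒜 ξ ((r : ℂ) • η) = (r : ℂ) • inner 𝒜 ξ η := by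
  rw [← PreHilbertModule.star_inner, inner_real_smul_left, star_smul, PreHilbertModule.star_inner,
    Complex.star_def, Complex.conj_ofReal]

/-- The form bound `β` is used twice: `p⟨Sξ,Sξ⟩ ≤ β p⟨Sξ,ξ⟩ ≤ β² p⟨ξ,ξ⟩`. -/
theorem isBounded_of_bounds (hS : ∀ ξ η, inner 𝒜 (S ξ) η = inner 𝒜 ξ (S η))
    (hpos : ∀ ξ : X, 0 ≤ inner 𝒜 (S ξ) ξ) (hcB : ActsCentrally X B)
    (hB : ∀ ξ, inner 𝒜 (S ξ) ξ ≤ B * inner 𝒜 ξ ξ * star B) : IsBounded 𝒜 S := by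
  intro p hp
  obtain ⟨C, _, _, _, φ, -, hφ⟩ := exists_cstarAlgebra_hom_of_mem hp
  obtain ⟨β, hβ, h⟩ := exists_map_inner_le φ hcB hB
  have h' : ∀ ξ, ‖φ (inner 𝒜 (S ξ) ξ)‖ ≤ β * ‖φ (inner 𝒜 ξ ξ)‖ := fun ξ => by
    have := CStarAlgebra.norm_le_norm_of_nonneg_of_le (map_nonneg φ (hpos ξ)) (h ξ)
    rwa [norm_smul, Real.norm_of_nonneg (by linarith)] at this
  refine ⟨β, by linarith, fun ξ => moduleSeminorm_le_of_sq_le (by linarith) ?_⟩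
  rw [← hφ, ← hφ, sq, mul_assoc]
  exact (norm_inner_apply_self_le φ hS (fun ξ => map_nonneg φ (hpos ξ)) (by linarith) h' ξ).trans
    (mul_le_mul_of_nonneg_left (h' ξ) (by linarith))

/-- Cancel `p̄(ξ)` in `p̄(ξ)² ≤ α p⟨Sξ,ξ⟩ ≤ α p̄(Sξ) p̄(ξ)`. -/
theorem exists_moduleSeminorm_le (hca : ActsCentrally X a)
    (haA : a * A = 1) (hA : ∀ ξ, A * inner 𝒜 ξ ξ * star A ≤ inner 𝒜 (S ξ) ξ)
    {p : Seminorm ℂ 𝒜} (hp : p ∈ contCStarSeminorms 𝒜) :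
    ∃ M : ℝ, 0 < M ∧ ∀ ξ : X, moduleSeminorm p ξ ≤ M * moduleSeminorm p (S ξ) := by
  obtain ⟨C, _, _, _, φ, -, hφ⟩ := exists_cstarAlgebra_hom_of_mem hp
  obtain ⟨α, hα, h⟩ := exists_le_map_inner φ hca haA hA
  refine ⟨α, by linarith, fun ξ => ?_⟩
  have h1 := CStarAlgebra.norm_le_norm_of_nonneg_of_le
    (map_nonneg φ (PreHilbertModule.inner_self_nonneg ξ)) (h ξ)
  rw [norm_smul, Real.norm_of_nonneg (by linarith), hφ, hφ, ← moduleSeminorm_sq] at h1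
  have h2 := mul_le_mul_of_nonneg_left (seminorm_inner_le hp (S ξ) ξ) (by linarith : 0 ≤ α)
  rcases (moduleSeminorm_nonneg p ξ).eq_or_lt with h3 | h3
  · rw [← h3]
    exact mul_nonneg (by linarith) (moduleSeminorm_nonneg _ _)
  · refine le_of_mul_le_mul_right ?_ h3
    nlinarith

/-- The range of `S` is dense for each of the seminorms, by a Neumann series argument. -/
theorem exists_moduleSeminorm_sub_lt (hS : ∀ ξ η, inner 𝒜 (S ξ) η = inner 𝒜 ξ (S η))
    (hca : ActsCentrally X a) (haA : a * A = 1)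
    (hA : ∀ ξ, A * inner 𝒜 ξ ξ * star A ≤ inner 𝒜 (S ξ) ξ) (hcB : ActsCentrally X B)
    (hB : ∀ ξ, inner 𝒜 (S ξ) ξ ≤ B * inner 𝒜 ξ ξ * star B)
    {p : Seminorm ℂ 𝒜} (hp : p ∈ contCStarSeminorms 𝒜) (η : X) {ε : ℝ} (hε : 0 < ε) :
    ∃ ξ, moduleSeminorm p (η - S ξ) < ε := by
  obtain ⟨C, _, _, _, φ, -, hφ⟩ := exists_cstarAlgebra_hom_of_mem hp
  obtain ⟨α, hα, hα'⟩ := exists_le_map_inner φ hca haA hA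
  obtain ⟨β, hβ, hβ'⟩ := exists_map_inner_le φ hcB hB
  have hα0 : 0 < α := by linarith
  have hβ0 : 0 < β := by linarith
  -- In the quotient for `p`, the form of `R = 1 - β⁻¹S` lies between `0` and `1 - (αβ)⁻¹ < 1`, so
  -- `R` is a strict contraction for `p̄`.
  let R : X → X := fun ξ => ξ - ((β⁻¹ : ℝ) : ℂ) • S ξ
  have hR : ∀ ξ η, inner 𝒜 (R ξ) η = inner 𝒜 ξ (R η) := fun ξ η => by
    simp only [R, inner_sub_left, inner_sub_right, inner_real_smul_left, inner_real_smul_right, hS]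
  have hRφ : ∀ ξ, φ (inner 𝒜 (R ξ) ξ) = φ (inner 𝒜 ξ ξ) - β⁻¹ • φ (inner 𝒜 (S ξ) ξ) := fun ξ => by
    rw [inner_sub_left, inner_real_smul_left, map_sub, map_smul, Complex.coe_smul]
  have hpos : ∀ ξ, 0 ≤ φ (inner 𝒜 (R ξ) ξ) := fun ξ => by
    have := smul_le_smul_of_nonneg_left (hβ' ξ) (inv_nonneg.2 hβ0.le)
    rw [smul_smul, inv_mul_cancel₀ hβ0.ne', one_smul] at this
    rw [hRφ]
    exact sub_nonneg.2 this
  have hρ1 : β⁻¹ * α⁻¹ ≤ 1 := by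
    rw [← mul_inv]
    exact inv_le_one_of_one_le₀ (by nlinarith)
  have hρ0 : 0 ≤ 1 - β⁻¹ * α⁻¹ := by linarith
  have hρ2 : 1 - β⁻¹ * α⁻¹ < 1 := by
    have : 0 < β⁻¹ * α⁻¹ := by positivity
    linarith
  have hle : ∀ ξ, ‖φ (inner 𝒜 (R ξ) ξ)‖ ≤ (1 - β⁻¹ * α⁻¹) * ‖φ (inner 𝒜 ξ ξ)‖ := fun ξ => by
    have h1 : φ (inner 𝒜 (R ξ) ξ) ≤ (1 - β⁻¹ * α⁻¹) • φ (inner 𝒜 ξ ξ) := by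
      have := smul_le_smul_of_nonneg_left (hα' ξ) (by positivity : 0 ≤ β⁻¹ * α⁻¹)
      rw [smul_smul _ α, mul_assoc, inv_mul_cancel₀ hα0.ne', mul_one] at this
      rw [hRφ, sub_smul, one_smul]
      exact sub_le_sub_left this _
    have := CStarAlgebra.norm_le_norm_of_nonneg_of_le (hpos ξ) h1
    rwa [norm_smul, Real.norm_of_nonneg hρ0] at this
  have hcontr : ∀ ξ, moduleSeminorm p (R ξ) ≤ (1 - β⁻¹ * α⁻¹) * moduleSeminorm p ξ := fun ξ => by
    refine moduleSeminorm_le_of_sq_le hρ0 ?_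
    rw [← hφ, ← hφ, sq, mul_assoc]
    exact (norm_inner_apply_self_le φ hR hpos hρ0 hle ξ).trans
      (mul_le_mul_of_nonneg_left (hle ξ) hρ0)
  have hiter : ∀ n : ℕ, ∃ ξ, moduleSeminorm p (η - S ξ) ≤
      (1 - β⁻¹ * α⁻¹) ^ n * moduleSeminorm p η := fun n => by
    induction n with
    | zero => exact ⟨0, by simp⟩
    | succ n ih =>
      obtain ⟨ξ, hξ⟩ := ih
      -- Correcting `ξ` by `β⁻¹` times the residual `η - Sξ` replaces that residual by its image
      -- under `R`.
      refine ⟨ξ + ((β⁻¹ : ℝ) : ℂ) • (η - S ξ), ?_⟩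
      have : η - S (ξ + ((β⁻¹ : ℝ) : ℂ) • (η - S ξ)) = R (η - S ξ) := by
        simp only [R, map_add, map_complex_smul]
        abel
      rw [this, pow_succ', mul_assoc]
      exact (hcontr _).trans (mul_le_mul_of_nonneg_left hξ hρ0)
  have hlim := (tendsto_pow_atTop_nhds_zero_of_lt_one hρ0 hρ2).mul_const (moduleSeminorm p η)
  rw [zero_mul] at hlim
  obtain ⟨n, hn⟩ := (hlim.eventually_lt_const hε).exists
  obtain ⟨ξ, hξ⟩ := hiter n
  exact ⟨ξ, hξ.trans_lt hn⟩

/-- The lower bound for the inverse of `S`, written at `ξ = S u`. -/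
theorem inverse_lower_bound (hS : ∀ ξ η, inner 𝒜 (S ξ) η = inner 𝒜 ξ (S η))
    (hpos : ∀ ξ : X, 0 ≤ inner 𝒜 (S ξ) ξ) (hcb : ActsCentrally X b) (hBb : B * b = 1)
    (hB : ∀ ξ, inner 𝒜 (S ξ) ξ ≤ B * inner 𝒜 ξ ξ * star B) (u : X) :
    b * inner 𝒜 (S u) (S u) * star b ≤ inner 𝒜 (S u) u := by
  set v := S u with hv
  -- Since `Bζ = b⋆v`, the upper bound yields `⟨Sζ,ζ⟩ ≤ ⟨bv,bv⟩`. Positivity of `S` at `u - ζ` then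
  -- gives `0 ≤ ⟨v,u⟩ - 2⟨bv,bv⟩ + ⟨Sζ,ζ⟩ ≤ ⟨v,u⟩ - ⟨bv,bv⟩`.
  set ζ := star b • b • v with hζ
  have hBζ : B • ζ = star b • v := by
    rw [hζ, hcb.star, ← mul_smul, hBb, one_smul]
  have h1 : inner 𝒜 (star b • v) (star b • v) = inner 𝒜 (b • v) (b • v) := by
    rw [hcb.star.inner_smul_left, star_star, ← hcb.star, ← hcb.inner_smul_left]
  have h2 : inner 𝒜 v ζ = inner 𝒜 (b • v) (b • v) := (hcb.inner_smul_left v (b • v)).symm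
  have h3 : inner 𝒜 ζ v = inner 𝒜 (b • v) (b • v) := by
    rw [← PreHilbertModule.star_inner v ζ, h2, PreHilbertModule.star_inner]
  have h4 := hpos (u - ζ)
  rw [map_sub, inner_sub_left, inner_sub_right, inner_sub_right, ← hv, h2, hS ζ u, ← hv, h3] at h4
  have h5 := hB ζ
  rw [← inner_smul_smul, hBζ, h1] at h5
  rw [← inner_smul_smul, ← sub_nonneg]
  calc (0 : 𝒜) ≤ _ := add_nonneg h4 (sub_nonneg.2 h5)
    _ = inner 𝒜 v u - inner 𝒜 (b • v) (b • v) := by abel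

/-- The upper bound for the inverse of `S`, written at `ξ = S u`. -/
theorem inverse_upper_bound (hS : ∀ ξ η, inner 𝒜 (S ξ) η = inner 𝒜 ξ (S η))
    (hcA : ActsCentrally X A) (haA : a * A = 1)
    (hA : ∀ ξ, A * inner 𝒜 ξ ξ * star A ≤ inner 𝒜 (S ξ) ξ) (u : X) :
    inner 𝒜 (S u) u ≤ a * inner 𝒜 (S u) (S u) * star a := by
  set v := S u with hv
  -- The square of `av - A⋆u` expands to `⟨av,av⟩ - 2⟨v,u⟩ + ⟨Au,Au⟩`, and the last term is at most
  -- `⟨v,u⟩` by the lower bound.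
  have hw : a • (v - star A • A • u) = a • v - star A • u := by
    rw [hcA.star, smul_sub, ← mul_smul a A, haA, one_smul]
  have h1 : inner 𝒜 (star A • u) (star A • u) = inner 𝒜 (A • u) (A • u) := by
    rw [hcA.star.inner_smul_left, star_star, ← hcA.star, ← hcA.inner_smul_left]
  have h2 : inner 𝒜 (a • v) (star A • u) = inner 𝒜 v u := by
    rw [← hcA.inner_smul_left, hcA, ← mul_smul, haA, one_smul]
  have h3 : inner 𝒜 (star A • u) (a • v) = inner 𝒜 v u := by
    rw [← PreHilbertModule.star_inner, h2, PreHilbertModule.star_inner, hS]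
  have h4 := PreHilbertModule.inner_self_nonneg (𝒜 := 𝒜) (a • (v - star A • A • u))
  rw [hw, inner_sub_left, inner_sub_right, inner_sub_right, h1, h2, h3] at h4
  have h5 := hA u
  rw [← inner_smul_smul] at h5
  rw [← inner_smul_smul, ← sub_nonneg]
  calc (0 : 𝒜) ≤ _ := add_nonneg h4 (sub_nonneg.2 h5)
    _ = inner 𝒜 (a • v) (a • v) - inner 𝒜 v u := by abel

end PreHilbert

end Inverse

/-! ### Invertibility of `S` in a Hilbert module -/

variable {𝒜 : Type u} {X : Type*} [Ring 𝒜] [StarRing 𝒜] [Algebra ℂ 𝒜] [StarModule ℂ 𝒜]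
  [UniformSpace 𝒜] [ProCStarAlgebra 𝒜] [PartialOrder 𝒜] [StarOrderedRing 𝒜]
  [AddCommGroup X] [Module ℂ X] [Module 𝒜 X] [IsScalarTower ℂ 𝒜 X]
  [UniformSpace X] [IsUniformAddGroup X] [HilbertModule 𝒜 X]

/-- The bounds from above and below make `S` uniformly inducing, so its range is complete, hence
closed. Directedness of the seminorms turns density for each one into density in `X`. -/
theorem surjective_of_bounds {S : Module.End 𝒜 X}
    (hbd : IsBounded 𝒜 S)
    (hbelow : ∀ p ∈ contCStarSeminorms 𝒜, ∃ M : ℝ, 0 < M ∧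
      ∀ ξ : X, moduleSeminorm p ξ ≤ M * moduleSeminorm p (S ξ))
    (hdense : ∀ p ∈ contCStarSeminorms 𝒜, ∀ (η : X) (ε : ℝ), 0 < ε →
      ∃ ξ, moduleSeminorm p (η - S ξ) < ε) : Function.Surjective S := by
  have : CompleteSpace X := HilbertModule.complete 𝒜
  have : T2Space X := t2Space_of_hilbertModule 𝒜
  have hcomap : Filter.comap S (𝓝 0) = 𝓝 0 := by
    apply le_antisymm
    · intro e he
      obtain ⟨p, hp, ε, hε, H⟩ := (mem_nhds_zero_iff 𝒜).1 he
      obtain ⟨M, hM, hM'⟩ := hbelow p hp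
      refine ⟨{ξ | moduleSeminorm p ξ < ε / M},
        (mem_nhds_zero_iff 𝒜).2 ⟨p, hp, ε / M, by positivity, fun _ h => h⟩, fun ξ hξ => H ξ ?_⟩
      calc moduleSeminorm p ξ ≤ M * moduleSeminorm p (S ξ) := hM' ξ
        _ < M * (ε / M) := mul_lt_mul_of_pos_left hξ hM
        _ = ε := mul_div_cancel₀ _ hM.ne'
    · rw [← Filter.tendsto_iff_comap]
      intro e he
      obtain ⟨p, hp, ε, hε, H⟩ := (mem_nhds_zero_iff 𝒜).1 he
      obtain ⟨M, hM, hM'⟩ := hbd p hp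
      refine (mem_nhds_zero_iff 𝒜).2 ⟨p, hp, ε / M, by positivity, fun ξ hξ => H _ ?_⟩
      calc moduleSeminorm p (S ξ) ≤ M * moduleSeminorm p ξ := hM' ξ
        _ < M * (ε / M) := mul_lt_mul_of_pos_left hξ hM
        _ = ε := mul_div_cancel₀ _ hM.ne'
  have hind : IsUniformInducing S := ⟨by
    rw [uniformity_eq_comap_nhds_zero X]
    conv_rhs => rw [← hcomap]
    rw [Filter.comap_comap, Filter.comap_comap]
    congr 1
    ext x
    simp⟩
  have hclosed : IsClosed (Set.range S) := hind.isComplete_range.isClosed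
  have hdr : DenseRange S := fun η => by
    rw [mem_closure_iff_nhds]
    intro t ht
    have ht' : (fun ζ => η - ζ) ⁻¹' t ∈ 𝓝 (0 : X) :=
      (by fun_prop : Continuous fun ζ : X => η - ζ).continuousAt.preimage_mem_nhds
        (by simpa using ht)
    obtain ⟨p, hp, ε, hε, H⟩ := (mem_nhds_zero_iff 𝒜).1 ht'
    obtain ⟨ξ, hξ⟩ := hdense p hp η ε hε
    exact ⟨S ξ, by simpa using H _ hξ, ξ, rfl⟩
  rw [← Set.range_eq_univ, ← hclosed.closure_eq]
  exact hdr.closure_range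

/-- A symmetric module map bounded below and above by invertible elements is invertible in
`Hom⋆_𝒜(X)`, and its inverse is bounded by the inverses of these elements. -/
theorem exists_unit_of_bounds {A a B b : 𝒜} (hAa : A * a = 1) (haA : a * A = 1)
    (hBb : B * b = 1) (hbB : b * B = 1) (S : Module.End 𝒜 X)
    (hS : ∀ ξ η, inner 𝒜 (S ξ) η = inner 𝒜 ξ (S η))
    (hA : ∀ ξ, A * inner 𝒜 ξ ξ * star A ≤ inner 𝒜 (S ξ) ξ)
    (hB : ∀ ξ, inner 𝒜 (S ξ) ξ ≤ B * inner 𝒜 ξ ξ * star B) :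
    ∃ V : (AdjointableHom 𝒜 X)ˣ, ((V : AdjointableHom 𝒜 X) : Module.End 𝒜 X) = S ∧
      ∀ u, b * inner 𝒜 (S u) (S u) * star b ≤ inner 𝒜 (S u) u ∧
        inner 𝒜 (S u) u ≤ a * inner 𝒜 (S u) (S u) * star a := by
  have hpos : ∀ ξ : X, 0 ≤ inner 𝒜 (S ξ) ξ := fun ξ =>
    (star_right_conjugate_nonneg (PreHilbertModule.inner_self_nonneg ξ) A).trans (hA ξ)
  obtain ⟨hcA, hcB⟩ := actsCentrally_of_bounds hAa hBb hbB S hA hB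
  have hca := hcA.of_mul_eq_one haA hAa
  have hcb := hcB.of_mul_eq_one hbB hBb
  have hbd := isBounded_of_bounds hS hpos hcB hB
  have hbelow : ∀ p ∈ contCStarSeminorms 𝒜, _ := fun p hp => exists_moduleSeminorm_le hca haA hA hp
  have hsurj := surjective_of_bounds hbd hbelow fun p hp η ε hε =>
    exists_moduleSeminorm_sub_lt hS hca haA hA hcB hB hp η hε
  have hinj : Function.Injective S := (injective_iff_map_eq_zero S).2 fun ξ hξ =>
    (PreHilbertModule.inner_self_eq_zero (𝒜 := 𝒜) ξ).1 <| eq_zero_of_forall_seminorm fun p hp => by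
      obtain ⟨M, hM, h⟩ := hbelow p hp
      have := h ξ
      rw [hξ, moduleSeminorm_zero, mul_zero] at this
      rw [← moduleSeminorm_sq, le_antisymm this (moduleSeminorm_nonneg _ _), sq, zero_mul]
  let e := LinearEquiv.ofBijective S ⟨hinj, hsurj⟩
  have he : ∀ ξ, S (e.symm ξ) = ξ := e.apply_symm_apply
  have he' : ∀ ξ, e.symm (S ξ) = ξ := e.symm_apply_apply
  let S₁ : AdjointableHom 𝒜 X := ⟨S, hbd, S, hS⟩
  let S₂ : AdjointableHom 𝒜 X := ⟨(e.symm : X →ₗ[𝒜] X), fun p hp => by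
      obtain ⟨M, hM, h⟩ := hbelow p hp
      exact ⟨M, hM, fun ξ => by simpa only [LinearEquiv.coe_coe, he] using h (e.symm ξ)⟩,
    e.symm, fun ξ η => by
      rw [LinearEquiv.coe_coe]
      nth_rewrite 1 [← he η]
      rw [← hS, he]⟩
  exact ⟨⟨S₁, S₂, Subtype.ext (LinearMap.ext he), Subtype.ext (LinearMap.ext he')⟩, rfl, fun u =>
    ⟨inverse_lower_bound hS hpos hcb hBb hB u, inverse_upper_bound hS hcA haA hA u⟩⟩

/-! ### Convergence of the frame operator series -/

section FrameOperator

variable {ι : Type*} {T : ι → AdjointableHom 𝒜 X} {s : X → 𝒜} {B : 𝒜}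

/-- The finite sums of positive terms lie below the full sum, so the constant `p B ^ 2` is uniform
in `F`. -/
theorem seminorm_sum_inner_le
    (hs : ∀ ξ, HasSum (fun i => inner 𝒜 ((T i : Module.End 𝒜 X) ξ) ((T i : Module.End 𝒜 X) ξ))
      (s ξ))
    (hs0 : ∀ ξ, 0 ≤ s ξ) (hB : ∀ ξ, s ξ ≤ B * inner 𝒜 ξ ξ * star B) {p : Seminorm ℂ 𝒜}
    (hp : p ∈ contCStarSeminorms 𝒜) (F : Finset ι) (ξ : X) :
    p (∑ i ∈ F, inner 𝒜 ((T i : Module.End 𝒜 X) ξ) ((T i : Module.End 𝒜 X) ξ)) ≤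
      p B ^ 2 * p (inner 𝒜 ξ ξ) := by
  have hnn : ∀ G : Finset ι,
      0 ≤ ∑ i ∈ G, inner 𝒜 ((T i : Module.End 𝒜 X) ξ) ((T i : Module.End 𝒜 X) ξ) := fun G =>
    Finset.sum_nonneg fun _ _ => PreHilbertModule.inner_self_nonneg _
  have hlim := (hp.1.tendsto (s ξ)).comp (hs ξ)
  have h1 : p (∑ i ∈ F, inner 𝒜 ((T i : Module.End 𝒜 X) ξ) ((T i : Module.End 𝒜 X) ξ)) ≤
      p (s ξ) := ge_of_tendsto hlim <| (Filter.eventually_ge_atTop F).mono fun G hG =>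
    seminorm_mono hp (hnn F) (Finset.sum_le_sum_of_subset_of_nonneg hG fun _ _ _ =>
      PreHilbertModule.inner_self_nonneg _)
  calc _ ≤ p (s ξ) := h1
    _ ≤ p (B * inner 𝒜 ξ ξ * star B) := seminorm_mono hp (hs0 ξ) (hB ξ)
    _ ≤ p B * p (inner 𝒜 ξ ξ) * p (star B) :=
      (hp.2.1 _ _).trans (mul_le_mul_of_nonneg_right (hp.2.1 _ _) (apply_nonneg _ _))
    _ = p B ^ 2 * p (inner 𝒜 ξ ξ) := by rw [cstar_seminorm_star hp.2.1 hp.2.2]; ring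

theorem inner_adjoint_left (U : AdjointableHom 𝒜 X) (ξ η : X) :
    inner 𝒜 (adjoint U ξ) η = inner 𝒜 ξ ((U : Module.End 𝒜 X) η) := by
  rw [← PreHilbertModule.star_inner, ← inner_adjoint, PreHilbertModule.star_inner]

/-- For a finite block `R = ∑_{i ∈ G} T_i⋆ T_i`, one has `p̄(Rξ)² ≤ p(B)² p⟨Rξ,ξ⟩`, and `⟨Rξ,ξ⟩` is
a block of the convergent series `∑ ⟨T_i ξ, T_i ξ⟩`. The Cauchy criterion therefore passes from `𝒜`
to `X`. -/
theorem summable_adjoint_apply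
    (hs : ∀ ξ, HasSum (fun i => inner 𝒜 ((T i : Module.End 𝒜 X) ξ) ((T i : Module.End 𝒜 X) ξ))
      (s ξ))
    (hs0 : ∀ ξ, 0 ≤ s ξ) (hB : ∀ ξ, s ξ ≤ B * inner 𝒜 ξ ξ * star B) (ξ : X) :
    Summable fun i => adjoint (T i) ((T i : Module.End 𝒜 X) ξ) := by
  have : CompleteSpace X := HilbertModule.complete 𝒜
  rw [summable_iff_vanishing]
  intro e he
  obtain ⟨p, hp, ε, hε, H⟩ := (mem_nhds_zero_iff 𝒜).1 he
  obtain ⟨C, _, _, _, φ, -, hφ⟩ := exists_cstarAlgebra_hom_of_mem hp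
  -- The `+ 1` keeps the denominator positive when `p B = 0`.
  have hδ : 0 < ε ^ 2 / (p B ^ 2 + 1) := by positivity
  have hnhds : {a : 𝒜 | p a < ε ^ 2 / (p B ^ 2 + 1)} ∈ 𝓝 (0 : 𝒜) :=
    hp.1.continuousAt.eventually_lt_const (by rwa [map_zero])
  obtain ⟨F, hF⟩ := summable_iff_vanishing.1 (hs ξ).summable _ hnhds
  refine ⟨F, fun G hG => H _ ?_⟩
  let R : X → X := fun ξ => ∑ i ∈ G, adjoint (T i) ((T i : Module.End 𝒜 X) ξ)
  have hinner : ∀ ξ η, inner 𝒜 (R ξ) η =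
      ∑ i ∈ G, inner 𝒜 ((T i : Module.End 𝒜 X) ξ) ((T i : Module.End 𝒜 X) η) := fun ξ η => by
    simp only [R, inner_sum_left, inner_adjoint_left]
  have hR : ∀ ξ η, inner 𝒜 (R ξ) η = inner 𝒜 ξ (R η) := fun ξ η => by
    rw [← PreHilbertModule.star_inner (R η) ξ, hinner, hinner, star_sum]
    simp only [PreHilbertModule.star_inner]
  have hpos : ∀ ξ, 0 ≤ φ (inner 𝒜 (R ξ) ξ) := fun ξ => by
    rw [hinner]
    exact map_nonneg φ (Finset.sum_nonneg fun _ _ => PreHilbertModule.inner_self_nonneg _)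
  have h1 := norm_inner_apply_self_le φ hR hpos (sq_nonneg (p B)) (fun ξ => by
    rw [hinner, hφ, hφ]
    exact seminorm_sum_inner_le hs hs0 hB hp G ξ) ξ
  have h2 : p (inner 𝒜 (R ξ) ξ) < ε ^ 2 / (p B ^ 2 + 1) := by
    rw [hinner]
    exact hF G hG
  rw [hφ, hφ, ← moduleSeminorm_sq] at h1
  rw [lt_div_iff₀ (by positivity)] at h2
  refine lt_of_pow_lt_pow_left₀ 2 hε.le (h1.trans_lt ?_)
  nlinarith [apply_nonneg p (inner 𝒜 (R ξ) ξ)]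

end FrameOperator

end ProCStar

/-! ### The frame operator and the dual frame -/

theorem corollary3p10 {𝒜 X ι : Type*}
    [Ring 𝒜] [StarRing 𝒜] [Algebra ℂ 𝒜] [StarModule ℂ 𝒜] [UniformSpace 𝒜]
    [ProCStar.ProCStarAlgebra 𝒜] [PartialOrder 𝒜] [StarOrderedRing 𝒜]
    [AddCommGroup X] [Module ℂ X] [Module 𝒜 X] [IsScalarTower ℂ 𝒜 X]
    [UniformSpace X] [IsUniformAddGroup X] [ProCStar.HilbertModule 𝒜 X]
    [Countable ι] (T : ι → ProCStar.AdjointableHom 𝒜 X)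
    (hT : ProCStar.IsStarOperatorFrame T) :
    ∃ S : (ProCStar.AdjointableHom 𝒜 X)ˣ,
      ProCStar.IsFrameOperator T (S : ProCStar.AdjointableHom 𝒜 X) ∧
        ProCStar.IsStarOperatorFrame
          (fun i => T i * ((S⁻¹ : (ProCStar.AdjointableHom 𝒜 X)ˣ) :
            ProCStar.AdjointableHom 𝒜 X)) := by
  obtain ⟨_, _, ⟨A, rfl⟩, ⟨B, rfl⟩, h⟩ := hT
  choose s hs hA hB using h
  have hs0 : ∀ ξ, 0 ≤ s ξ := fun ξ => (star_right_conjugate_nonneg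
    (ProCStar.PreHilbertModule.inner_self_nonneg ξ) (A : 𝒜)).trans (hA ξ)
  have hsum := fun ξ => (ProCStar.summable_adjoint_apply hs hs0 hB ξ).hasSum
  set S := fun ξ => ∑' i, ProCStar.adjoint (T i) ((T i : Module.End 𝒜 X) ξ)
  have hinner : ∀ ξ η, HasSum
      (fun i => inner 𝒜 ((T i : Module.End 𝒜 X) ξ) ((T i : Module.End 𝒜 X) η))
      (inner 𝒜 (S ξ) η) := fun ξ η => by
    have := (hsum ξ).map (ProCStar.innerLeft (𝒜 := 𝒜) η) (ProCStar.continuous_inner_left η)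
    refine this.congr_fun fun i => ?_
    exact (ProCStar.inner_adjoint_left _ _ _).symm
  have hS : ∀ ξ η, inner 𝒜 (S ξ) η = inner 𝒜 ξ (S η) := fun ξ η => by
    rw [← ProCStar.PreHilbertModule.star_inner (S η) ξ]
    refine (hinner ξ η).unique ((hinner η ξ).star.congr_fun fun i => ?_)
    exact (ProCStar.PreHilbertModule.star_inner _ _).symm
  have hsS : ∀ ξ, s ξ = inner 𝒜 (S ξ) ξ := fun ξ => (hs ξ).unique (hinner ξ ξ)
  simp only [hsS] at hA hB
  obtain ⟨V, hV, hbounds⟩ := ProCStar.exists_unit_of_bounds A.mul_inv A.inv_mul B.mul_inv B.inv_mul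
    (ProCStar.endOfSymmetric S hS) hS hA hB
  have hVS : ∀ ξ, ((V : ProCStar.AdjointableHom 𝒜 X) : Module.End 𝒜 X) ξ = S ξ := fun ξ => by
    rw [hV]; rfl
  refine ⟨V, fun ξ => ?_, ((B⁻¹ : 𝒜ˣ) : 𝒜), ((A⁻¹ : 𝒜ˣ) : 𝒜), B⁻¹.isUnit, A⁻¹.isUnit, fun ξ => ?_⟩
  · rw [hVS]
    exact hsum ξ
  -- At `ξ = Su` the new family takes the values `T_i u`, so its series sums to `⟨Su, u⟩`, the
  -- quantity already bounded in `hbounds`.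
  · obtain ⟨u, rfl⟩ : ∃ u, ξ = S u :=
      ⟨((V⁻¹ : (ProCStar.AdjointableHom 𝒜 X)ˣ) : Module.End 𝒜 X) ξ, by
        rw [← hVS]
        exact (LinearMap.congr_fun (congrArg Subtype.val V.mul_inv) ξ).symm⟩
    have hu : ((V⁻¹ : (ProCStar.AdjointableHom 𝒜 X)ˣ) : Module.End 𝒜 X) (S u) = u := by
      rw [← hVS]
      exact LinearMap.congr_fun (congrArg Subtype.val V.inv_mul) u
    refine ⟨inner 𝒜 (S u) u, (hinner u u).congr_fun fun i => ?_, hbounds u⟩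
    simp only [Submonoid.coe_mul, Module.End.mul_apply, hu]
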